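/- **Theorem (Orbit Splitting Theorem).** Let $V$ be a finite-dimensional real inner product space, and let $A^*$ denote the adjoint of $A\in\mathfrak{gl}(V)=\mathrm{End}_{\mathbb R}(V)$. Let $\gamma:\mathfrak{gl}(V)\to\mathfrak{gl}(V)$ be a linear map with $\gamma\circ\gamma=\mathrm{id}$ which is either an automorphism ($\gamma(AB)=\gamma(A)\gamma(B)$ for all $A,B$; put $\sigma(\gamma)=1$) or an anti-automorphism ($\gamma(AB)=\gamma(B)\gamma(A)$ for all $A,B$; put $\sigma(\gamma)=-1$). Let $s\in GL(V)$ be a structure map of $\gamma$, i.e. $\gamma(A)=s^{-1}As$ for all $A$ if $\gamma$ is an automorphism, and $\gamma(A)=s^{-1}A^*s$ for all $A$ if $\gamma$ is an anti-automorphism. For $\mu\in\mathbb R$ put $$\mathfrak{gl}_\mu(V)=\{A\in\mathfrak{gl}(V)\mid \gamma(A)=\mu A\},\qquad GL_s^{\sigma(\gamma)}(V)=\{g\in GL(V)\mid \gamma(g)=g^{\sigma(\gamma)}\}.$$ Let $L\in\mathfrak{gl}_\mu(V)$, and assume that $V$ is indecomposable with respect to $(L,s)$: $V$ is not the direct sum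 $U\oplus W$ of two nonzero $L$-invariant subspaces such that $U$ and $W$ are $s$-invariant (if $\gamma$ is an automorphism), respectively such that $U$ and $W$ are orthogonal to each other for the bilinear form $\omega(x,y)=\langle x,sy\rangle$ (if $\gamma$ is an anti-automorphism). Then $$\{gLg^{-1}\mid g\in GL(V)\}\cap\mathfrak{gl}_\mu(V)$$ consists of at most two orbits of $GL_s^{\sigma(\gamma)}(V)$ acting by conjugation; that is, there are $M_1,M_2\in\mathfrak{gl}(V)$ (possibly equal) such that this set is the union of the $GL_s^{\sigma(\gamma)}(V)$-orbits of $M_1$ and $M_2$. -/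

import Mathlib

namespace OrbitSplitting

variable {V : Type*}

/-- The two kinds of multiplicative linear maps of `gl(V)`. -/
inductive Kind
  | aut
  | antiAut

/-- The sign `σ(γ)`: `1` for automorphisms and `-1` for anti-automorphisms. -/
def Kind.sign : Kind → ℤ
  | .aut => 1
  | .antiAut => -1

section Algebra

variable [AddCommGroup V] [Module ℝ V]

/-- `γ` is multiplicative (kind `aut`) or reverses products (kind `antiAut`). -/
def IsMultiplicative : Kind → Module.End ℝ (Module.End ℝ V) → Prop
  | .aut, γ => ∀ A B, γ (A * B) = γ A * γ B
  | .antiAut, γ => ∀ A B, γ (A * B) = γ B * γ A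

/-- `γ` is an (anti)-automorphism of `gl(V)`, of the given kind, with `γ ∘ γ = id`. -/
structure IsInvolutiveOfKind (κ : Kind) (γ : Module.End ℝ (Module.End ℝ V)) : Prop where
  mult : IsMultiplicative κ γ
  invol : ∀ A, γ (γ A) = A

theorem IsInvolutiveOfKind.map_one {κ : Kind} {γ : Module.End ℝ (Module.End ℝ V)}
    (h : IsInvolutiveOfKind κ γ) : γ 1 = 1 := by
  obtain ⟨hm, hi⟩ := h
  cases κ with
  | aut =>
    have h1 := hm (γ 1) 1
    rwa [mul_one, hi, one_mul, eq_comm] at h1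
  | antiAut =>
    have h1 := hm (γ 1) 1
    rwa [mul_one, hi, mul_one, eq_comm] at h1

/-- The group of structure preserving transformations
`{g ∈ GL(V) | γ(g) = g ^ σ(γ)}`. -/
def structureGroup (κ : Kind) (γ : Module.End ℝ (Module.End ℝ V))
    (hγ : IsInvolutiveOfKind κ γ) : Subgroup (LinearMap.GeneralLinearGroup ℝ V) where
  carrier := {g | γ (g : Module.End ℝ V)
    = ((g ^ κ.sign : LinearMap.GeneralLinearGroup ℝ V) : Module.End ℝ V)}
  one_mem' := by simpa using hγ.map_one
  mul_mem' := by
    intro a b ha hb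
    have hm := hγ.mult
    cases κ with
    | aut =>
      simp only [Kind.sign, zpow_one, Set.mem_ofPred_eq] at ha hb ⊢
      rw [Units.val_mul, hm, ha, hb]
    | antiAut =>
      simp only [Kind.sign, zpow_neg, zpow_one, Set.mem_ofPred_eq] at ha hb ⊢
      rw [Units.val_mul, hm, ha, hb, mul_inv_rev, Units.val_mul]
  inv_mem' := by
    intro a ha
    have hm := hγ.mult
    have h1 := hγ.map_one
    cases κ with
    | aut =>
      simp only [Kind.sign, zpow_one, Set.mem_ofPred_eq] at ha ⊢
      have h2 := hm (a : Module.End ℝ V) ((a⁻¹ : LinearMap.GeneralLinearGroup ℝ V))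
      rw [Units.mul_inv, h1, ha] at h2
      exact (Units.inv_eq_of_mul_eq_one_right h2.symm).symm
    | antiAut =>
      simp only [Kind.sign, zpow_neg, zpow_one, inv_inv, Set.mem_ofPred_eq] at ha ⊢
      have h2 := hm ((a⁻¹ : LinearMap.GeneralLinearGroup ℝ V)) (a : Module.End ℝ V)
      rw [Units.inv_mul, h1, ha] at h2
      have h3 := Units.inv_eq_of_mul_eq_one_right h2.symm
      rw [inv_inv] at h3
      exact h3.symm

/-- The orbit `{g L g⁻¹ | g ∈ G}` of `L` under conjugation by a subgroup `G` of `GL(V)`. -/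
def conjOrbit (G : Subgroup (LinearMap.GeneralLinearGroup ℝ V)) (L : Module.End ℝ V) :
    Set (Module.End ℝ V) :=
  {M | ∃ g ∈ G, M = (g : Module.End ℝ V) * L
    * ((g⁻¹ : LinearMap.GeneralLinearGroup ℝ V) : Module.End ℝ V)}

end Algebra

section Inner

variable [NormedAddCommGroup V] [InnerProductSpace ℝ V] [FiniteDimensional ℝ V]

/-- `s` is a structure map of `γ`: one has `γ(A) = s⁻¹ A s` for an automorphism and
`γ(A) = s⁻¹ A* s` for an anti-automorphism. -/
def IsStructureMap (κ : Kind) (γ : Module.End ℝ (Module.End ℝ V))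
    (s : LinearMap.GeneralLinearGroup ℝ V) : Prop :=
  match κ with
  | .aut => ∀ A : Module.End ℝ V, γ A =
      ((s⁻¹ : LinearMap.GeneralLinearGroup ℝ V) : Module.End ℝ V) * A * (s : Module.End ℝ V)
  | .antiAut => ∀ A : Module.End ℝ V, γ A =
      ((s⁻¹ : LinearMap.GeneralLinearGroup ℝ V) : Module.End ℝ V) * LinearMap.adjoint A
        * (s : Module.End ℝ V)

/-- Compatibility of a pair of subspaces with the structure map `s`. For automorphisms `s` is
an operator, and both subspaces have to be `s`-invariant. For anti-automorphisms `s` stands for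
the bilinear form `ω(x, y) = ⟪x, s y⟫`, and the subspaces have to be `ω`-orthogonal. -/
def StructureSplits (κ : Kind) (s : LinearMap.GeneralLinearGroup ℝ V)
    (U W : Submodule ℝ V) : Prop :=
  match κ with
  | .aut => (∀ u ∈ U, (s : Module.End ℝ V) u ∈ U) ∧ (∀ w ∈ W, (s : Module.End ℝ V) w ∈ W)
  | .antiAut => ∀ u ∈ U, ∀ w ∈ W,
      inner ℝ u ((s : Module.End ℝ V) w) = 0 ∧ inner ℝ w ((s : Module.End ℝ V) u) = 0

/-- The space `V` with the pair `(L, s)` is indecomposable: it is not the direct sum of two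
nonzero `L`-invariant subspaces that are compatible with `s`. -/
def IsIndecomposable (κ : Kind) (s : LinearMap.GeneralLinearGroup ℝ V)
    (L : Module.End ℝ V) : Prop :=
  ∀ U W : Submodule ℝ V, IsCompl U W → (∀ u ∈ U, L u ∈ U) → (∀ w ∈ W, L w ∈ W) →
    StructureSplits κ s U W → U = ⊥ ∨ W = ⊥

end Inner

end OrbitSplitting

/-! Put τ(g) = γ(g)^σ(γ) (`twist`). This is an involutive automorphism of GL(V) whose fixed points
form the structure group. Suppose L and gLg⁻¹ both lie in the μ-eigenspace of γ, with μ ≠ 0.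
Applying γ shows that h = τ(g)⁻¹g centralizes L, and τ(h) = h⁻¹. If some invertible f centralizing L
satisfies τ(f)h = ±f, then k = gf⁻¹ conjugates L to the same operator and τ(k) = ±k. The k with sign
+ yield the orbit of L; any two k with sign − differ by a left factor in the structure group, so
they yield at most one more orbit.

Indecomposability provides f. A γ-fixed operator a commuting with L is primary, since a coprime
factorization p(a)q(a) = 0 splits V into ker p(a) and ker q(a), compatibly with L and s. For an
automorphism this applies to h + h⁻¹ and makes 1 + h or 1 − h invertible, which serves as f. For an
anti-automorphism h itself is γ-fixed, and f is a polynomial in h with f² = ±h. -/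

namespace OrbitSplitting

open Polynomial

/-! ### Primary elements of finite-dimensional real algebras -/

/-- An element `a` of a real algebra is primary if, of two coprime polynomials whose product
annihilates `a`, one annihilates `a`. -/
def IsPrimaryElement {A : Type*} [Ring A] [Algebra ℝ A] (a : A) : Prop :=
  ∀ p q : ℝ[X], IsCoprime p q → aeval a p * aeval a q = 0 → aeval a p = 0 ∨ aeval a q = 0

section Primary

variable {A : Type*} [Ring A] [Algebra ℝ A] [FiniteDimensional ℝ A] {a : A}

/-- Split the minimal polynomial as P^j q with P not dividing q. One factor must vanish at a, and
q(a) = 0 would force P ∣ q. -/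
theorem IsPrimaryElement.isNilpotent_aeval (ha : IsPrimaryElement a) {P : ℝ[X]}
    (hP : Irreducible P) (hdvd : P ∣ minpoly ℝ a) : IsNilpotent (aeval a P) := by
  have hint : IsIntegral ℝ a := Algebra.IsIntegral.isIntegral a
  have hne := minpoly.ne_zero hint
  obtain ⟨q, hq, hnd⟩ := (FiniteMultiplicity.of_not_isUnit hP.not_isUnit hne).exists_eq_pow_mul_and_not_dvd
  set j := multiplicity P (minpoly ℝ a)
  have hco : IsCoprime (P ^ j) q :=
    ((hP.coprime_iff_not_dvd).2 hnd).pow_left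
  have h0 : aeval a (P ^ j) * aeval a q = 0 := by
    rw [← map_mul, ← hq, minpoly.aeval]
  rcases ha _ _ hco h0 with h | h
  · exact ⟨j, by simpa using h⟩
  · exact absurd (hdvd.trans (minpoly.dvd ℝ a h)) hnd

theorem IsPrimaryElement.isNilpotent_sub_of_isRoot (ha : IsPrimaryElement a) {c : ℝ}
    (hc : (minpoly ℝ a).IsRoot c) : IsNilpotent (a - algebraMap ℝ A c) := by
  simpa using ha.isNilpotent_aeval (irreducible_X_sub_C c) (dvd_iff_isRoot.2 hc)

/-- An irreducible polynomial in a primary element is a unit or nilpotent. -/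
theorem IsPrimaryElement.isUnit_or_isNilpotent_aeval (ha : IsPrimaryElement a) {P : ℝ[X]}
    (hP : Irreducible P) : IsUnit (aeval a P) ∨ IsNilpotent (aeval a P) := by
  rcases hP.isCoprime_or_dvd (minpoly ℝ a) with ⟨u, v, huv⟩ | h
  · left
    have h1 : aeval a u * aeval a P = 1 := by
      rw [← map_mul, ← map_one (aeval (R := ℝ) a), ← huv, map_add, map_mul _ v, minpoly.aeval, mul_zero,
        add_zero]
    have h2 : aeval a P * aeval a u = 1 := by rw [← map_mul, mul_comm, map_mul, h1]
    exact ⟨⟨_, _, h2, h1⟩, rfl⟩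
  · exact Or.inr (ha.isNilpotent_aeval hP h)

/-- A polynomial in a primary unit `a` whose square is `a` or `-a` up to a nilpotent. -/
theorem IsPrimaryElement.exists_aeval_sq_sub_isNilpotent (ha : IsPrimaryElement a)
    (hu : IsUnit a) :
    ∃ (ε : ℝ) (r : ℝ[X]), (ε = 1 ∨ ε = -1) ∧ IsNilpotent (aeval a (r ^ 2 - C ε * X)) := by
  rcases subsingleton_or_nontrivial A with hA | hA
  · exact ⟨1, 0, Or.inl rfl, ⟨1, Subsingleton.elim _ _⟩⟩
  -- With a real root c, a is c plus a nilpotent, and c ≠ 0 because a is a unit; the constant √|c|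
  -- then works, with ε the sign of c.
  by_cases hroot : ∃ c, (minpoly ℝ a).IsRoot c
  · obtain ⟨c, hc⟩ := hroot
    have hnil := ha.isNilpotent_sub_of_isRoot hc
    have hc0 : c ≠ 0 := by
      rintro rfl
      rw [map_zero, sub_zero] at hnil
      exact hnil.not_isUnit hu
    rcases lt_or_gt_of_ne hc0 with h | h
    · refine ⟨-1, C (√(-c)), Or.inr rfl, ?_⟩
      have h1 : aeval a (C (√(-c)) ^ 2 - C (-1) * X) = a - algebraMap ℝ A c := by
        rw [← C_pow, Real.sq_sqrt (by linarith)]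
        simp; abel
      rwa [h1]
    · refine ⟨1, C (√c), Or.inl rfl, ?_⟩
      have h1 : aeval a (C (√c) ^ 2 - C 1 * X) = -(a - algebraMap ℝ A c) := by
        rw [← C_pow, Real.sq_sqrt h.le]
        simp
      rw [h1]
      exact hnil.neg
  · push Not at hroot
    obtain ⟨P, hP, hdvd⟩ := WfDvdMonoid.exists_irreducible_factor
      (minpoly.not_isUnit ℝ a) (minpoly.ne_zero (Algebra.IsIntegral.isIntegral (R := ℝ) a))
    have hPr : ∀ x, P.eval x ≠ 0 := fun x hx => hroot x (IsRoot.dvd hx hdvd)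
    have hnil := ha.isNilpotent_aeval hP hdvd
    -- Real irreducible polynomials have degree at most two; without a real root, P is a quadratic
    -- of negative discriminant.
    obtain ⟨p₂, p₁, p₀, rfl⟩ : ∃ p₂ p₁ p₀ : ℝ, P = C p₂ * X ^ 2 + C p₁ * X + C p₀ :=
      ⟨_, _, _, eq_quadratic_of_degree_le_two hP.degree_le_two⟩
    have hPr' : ∀ x, p₂ * (x * x) + p₁ * x + p₀ ≠ 0 := fun x hx => hPr x (by
      simp; linarith)
    have hp₂ : p₂ ≠ 0 := by
      rintro rfl
      by_cases hp₁ : p₁ = 0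
      · subst hp₁
        apply hP.not_isUnit
        simp only [C_0, zero_mul, zero_add]
        exact isUnit_C.2 (isUnit_iff_ne_zero.2 (by simpa using hPr' 0))
      · exact hPr' (-p₀ / p₁) (by field_simp; ring)
    have hdisc : discrim p₂ p₁ p₀ < 0 := by
      by_contra! hd
      obtain ⟨x, hx⟩ := exists_quadratic_eq_zero hp₂ ⟨_, (Real.mul_self_sqrt hd).symm⟩
      exact hPr' x hx
    unfold discrim at hdisc
    obtain ⟨b, rfl⟩ : ∃ b, p₁ = p₂ * b := ⟨p₁ / p₂, by field_simp⟩
    obtain ⟨c, rfl⟩ : ∃ c, p₀ = p₂ * c := ⟨p₀ / p₂, by field_simp⟩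
    have hbc : b ^ 2 < 4 * c := by
      have : p₂ ^ 2 * (b ^ 2 - 4 * c) < 0 := by linarith
      have h2 : 0 < p₂ ^ 2 := by positivity
      nlinarith
    have hc : 0 ≤ c := by nlinarith
    obtain ⟨d, hd0, rfl⟩ : ∃ d, 0 ≤ d ∧ c = d ^ 2 := ⟨√c, Real.sqrt_nonneg c, (Real.sq_sqrt hc).symm⟩
    have hpos : 0 < 2 * d - b := by
      have := abs_lt_of_sq_lt_sq (by linarith : b ^ 2 < (2 * d) ^ 2) (by linarith)
      linarith [(abs_lt.1 this).2]
    obtain ⟨u, hu⟩ : ∃ u : ℝ, u ^ 2 * (2 * d - b) = 1 :=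
      ⟨√((2 * d - b)⁻¹), by rw [Real.sq_sqrt (by positivity)]; field_simp⟩
    -- Since P/p₂ = X² + bX + d², one has (X + d)² = P/p₂ + (2d − b)X; scaling by u² = 1/(2d − b)
    -- makes the last term X.
    refine ⟨1, C u * X + C (u * d), Or.inl rfl, ?_⟩
    have h1 : (C u * X + C (u * d)) ^ 2 - C 1 * X =
        C (u ^ 2 * p₂⁻¹) * (C p₂ * X ^ 2 + C (p₂ * b) * X + C (p₂ * d ^ 2)) := by
      have e1 : C (u ^ 2 * p₂⁻¹) * (C p₂ * X ^ 2 + C (p₂ * b) * X + C (p₂ * d ^ 2)) =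
          C (u ^ 2 * (p₂⁻¹ * p₂)) * (X ^ 2 + C b * X + C (d ^ 2)) := by
        simp only [C_mul]; ring
      have e2 : C (1 : ℝ) = C (u ^ 2 * (2 * d - b)) := by rw [hu]
      rw [e1, inv_mul_cancel₀ hp₂, e2]
      simp only [C_mul, C_pow, C_sub, C_1, map_ofNat]
      ring
    rw [h1, map_mul]
    exact ((Commute.all _ _).map (aeval (R := ℝ) a)).isNilpotent_mul_left hnil

/-- A primary unit is, up to sign, the square of a polynomial in itself. -/
theorem IsPrimaryElement.exists_sq_eq (ha : IsPrimaryElement a) (hu : IsUnit a) :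
    ∃ r : ℝ[X], aeval a r * aeval a r = a ∨ aeval a r * aeval a r = -a := by
  obtain ⟨ε, r, hε, hr⟩ := ha.exists_aeval_sq_sub_isNilpotent hu
  have hε0 : ε ≠ 0 := by rcases hε with rfl | rfl <;> norm_num
  -- Newton iteration needs a commutative ring, so the approximate root r(a) is refined to an exact
  -- one inside ℝ[a].
  let S := Algebra.adjoin ℝ {a}
  have : IsMulCommutative S := Algebra.isMulCommutative_adjoin ℝ (by simp)
  let b : S := ⟨a, Algebra.self_mem_adjoin_singleton ℝ a⟩
  have hval : ∀ p : ℝ[X], ((aeval b p : S) : A) = aeval a p := fun p =>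
    (aeval_algHom_apply S.val b p).symm
  have : IsArtinianRing S := IsArtinianRing.of_finite ℝ S
  -- The inverse of a must lie in ℝ[a]: in an Artinian ring a non-zero-divisor is a unit.
  have hb : IsUnit b := by
    refine IsArtinianRing.isUnit_of_mem_nonZeroDivisors (mem_nonZeroDivisors_iff_right.2 ?_)
    intro z hz
    exact Subtype.ext (hu.mul_left_eq_zero.1 (congrArg Subtype.val hz))
  have hnil : IsNilpotent (aeval b (r ^ 2 - C ε * X)) := by
    obtain ⟨n, hn⟩ := hr
    exact ⟨n, Subtype.ext (by rw [← map_pow, hval, map_pow, hn]; rfl)⟩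
  have hsq : IsUnit (aeval b r) := by
    have h1 : IsUnit (aeval b (C ε * X)) := by
      rw [map_mul, aeval_C, aeval_X]
      exact ((isUnit_iff_ne_zero.2 hε0).map _).mul hb
    have h2 : IsUnit (aeval b (r ^ 2)) := by
      have := hnil.isUnit_add_left_of_commute h1 (Commute.all _ _)
      rwa [← map_add, add_sub_cancel] at this
    rw [map_pow] at h2
    exact (isUnit_pow_iff two_ne_zero).1 h2
  -- Newton's method for X² − εa: the value at r(a) is nilpotent and the derivative 2r(a) is a unit.
  obtain ⟨x, ⟨-, hx⟩, -⟩ := existsUnique_nilpotent_sub_and_aeval_eq_zero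
    (P := (X ^ 2 - C (algebraMap ℝ S ε * b) : S[X])) (x := aeval b r)
    (by simpa using hnil) (by
      have h2 : IsUnit (algebraMap ℝ S 2) := (isUnit_iff_ne_zero.2 two_ne_zero).map _
      rw [map_ofNat] at h2
      simpa [one_add_one_eq_two] using h2.mul hsq)
  obtain ⟨q, hq⟩ : (x : A) ∈ (aeval a : ℝ[X] →ₐ[ℝ] A).range :=
    Algebra.adjoin_singleton_eq_range_aeval ℝ a ▸ x.2
  have hxx : (x : A) * x = algebraMap ℝ A ε * a := by
    have h1 : x * x = algebraMap ℝ S ε * b := by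
      simpa [sq, sub_eq_zero] using hx
    exact congrArg Subtype.val h1
  refine ⟨q, ?_⟩
  rw [show aeval a q = (x : A) from hq, hxx]
  rcases hε with rfl | rfl <;> simp

/-- If `h + h⁻¹` is primary, then `1` and `-1` are not both eigenvalues of `h`. -/
theorem IsPrimaryElement.isUnit_one_add_or_one_sub {h : Aˣ}
    (ha : IsPrimaryElement ((h : A) + (h⁻¹ : Aˣ))) :
    IsUnit (1 + (h : A)) ∨ IsUnit (1 - (h : A)) := by
  rcases subsingleton_or_nontrivial A with hA | hA
  · exact Or.inl (isUnit_of_subsingleton _)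
  set a : A := (h : A) + (h⁻¹ : Aˣ) with ha_def
  have hc : Commute (h : A) (h⁻¹ : Aˣ) := by simp [Commute, SemiconjBy]
  -- (1 ± h)²h⁻¹ = a ± 2. If neither 1 + h nor 1 − h were a unit, a + 2 and a − 2 would both be
  -- nilpotent, and so would their difference 4.
  have e1 : (1 + (h : A)) * ((1 + (h : A)) * (h⁻¹ : Aˣ)) = a - algebraMap ℝ A (-2) := by
    have : algebraMap ℝ A (-2) = -(1 + 1) := by
      rw [map_neg, map_ofNat, one_add_one_eq_two]
    rw [this, ha_def, add_mul 1 (h : A) ((h⁻¹ : Aˣ) : A), Units.mul_inv, one_mul, add_mul, mul_add,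
      mul_add, Units.mul_inv]
    simp only [mul_one, one_mul]
    abel
  have e2 : (1 - (h : A)) * ((1 - (h : A)) * (h⁻¹ : Aˣ)) = a - algebraMap ℝ A 2 := by
    have : algebraMap ℝ A 2 = 1 + 1 := by
      rw [map_ofNat, one_add_one_eq_two]
    rw [this, ha_def, sub_mul 1 (h : A) ((h⁻¹ : Aˣ) : A), Units.mul_inv, one_mul, sub_mul, mul_sub,
      mul_sub, Units.mul_inv]
    simp only [mul_one, one_mul]
    abel
  have key (x : A) (hx : Commute x ((h⁻¹ : Aˣ) : A)) (c : ℝ)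
      (e : x * (x * (h⁻¹ : Aˣ)) = a - algebraMap ℝ A c) :
      IsUnit x ∨ IsNilpotent (a - algebraMap ℝ A c) := by
    rcases ha.isUnit_or_isNilpotent_aeval (irreducible_X_sub_C c) with hu | hn
    · left
      have h3 : Commute x (x * (h⁻¹ : Aˣ)) := (Commute.refl x).mul_right hx
      simp only [map_sub, aeval_X, aeval_C] at hu
      rw [← e] at hu
      exact (h3.isUnit_mul_iff.1 hu).1
    · right
      simpa using hn
  rcases key _ ((Commute.one_left _).add_left hc) _ e1 with hu | h1
  · exact Or.inl hu
  rcases key _ ((Commute.one_left _).sub_left hc) _ e2 with hu | h2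
  · exact Or.inr hu
  exfalso
  have h3 : IsNilpotent (algebraMap ℝ A 4) := by
    have h4 := Commute.isNilpotent_sub (x := a - algebraMap ℝ A (-2)) (y := a - algebraMap ℝ A 2)
      (by
        have h5 : ∀ c, Commute a (algebraMap ℝ A c) := fun c => (Algebra.commutes c a).symm
        exact (((Commute.refl a).sub_right (h5 _))).sub_left
          ((h5 _).symm.sub_right (Algebra.commutes _ _))) h1 h2
    rwa [sub_sub_sub_cancel_left, ← map_sub, show (2 : ℝ) - -2 = 4 by norm_num] at h4
  exact h3.not_isUnit ((isUnit_iff_ne_zero.2 four_ne_zero).map _)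

end Primary

theorem _root_.Commute.aeval_left {R A : Type*} [CommRing R] [Ring A] [Algebra R A] {a b : A}
    (h : Commute a b) (p : R[X]) : Commute (aeval a p) b := by
  rw [aeval_eq_sum_range]
  exact Commute.sum_left _ _ _ fun i _ => (h.pow_left i).smul_left _

theorem _root_.Units.conj_eq_conj_iff {R : Type*} [Monoid R] (g k : Rˣ) (a : R) :
    (g : R) * a * (g⁻¹ : Rˣ) = k * a * (k⁻¹ : Rˣ) ↔ Commute ((k⁻¹ * g : Rˣ) : R) a := by
  rw [Units.mul_inv_eq_iff_eq_mul, mul_assoc (k : R), mul_assoc (k : R),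
    ← Units.inv_mul_eq_iff_eq_mul, Commute, SemiconjBy, Units.val_mul, mul_assoc, mul_assoc]

/-! ### The involution on GL(V) and its action on conjugates -/

section Involution

variable {V : Type*} [AddCommGroup V] [Module ℝ V] {κ : Kind}
  {γ : Module.End ℝ (Module.End ℝ V)}

theorem IsInvolutiveOfKind.map_aeval (h : IsInvolutiveOfKind κ γ) {a : Module.End ℝ V}
    (ha : γ a = a) (p : ℝ[X]) : γ (aeval a p) = aeval a p := by
  have hpow : ∀ n, γ (a ^ n) = a ^ n := by
    intro n
    induction n with
    | zero => simpa using h.map_one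
    | succ n ih =>
      have hm := h.mult
      cases κ with
      | aut => rw [pow_succ, hm, ih, ha]
      | antiAut => rw [pow_succ, hm, ih, ha, ← pow_succ, ← pow_succ']
  rw [aeval_eq_sum_range, map_sum]
  simp [hpow]

/-- The involution `g ↦ γ(g) ^ σ(γ)` of `GL(V)`, whose fixed points form the structure group. -/
def twist (hγ : IsInvolutiveOfKind κ γ) :
    LinearMap.GeneralLinearGroup ℝ V →* LinearMap.GeneralLinearGroup ℝ V :=
  match κ, hγ with
  | .aut, hγ =>
    { toFun := fun g => ⟨γ g, γ (g⁻¹ : LinearMap.GeneralLinearGroup ℝ V),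
        by rw [← hγ.mult, Units.mul_inv, hγ.map_one],
        by rw [← hγ.mult, Units.inv_mul, hγ.map_one]⟩
      map_one' := Units.ext hγ.map_one
      map_mul' := fun a b => Units.ext (hγ.mult _ _) }
  | .antiAut, hγ =>
    { toFun := fun g => ⟨γ (g⁻¹ : LinearMap.GeneralLinearGroup ℝ V), γ g,
        by rw [← hγ.mult, Units.mul_inv, hγ.map_one],
        by rw [← hγ.mult, Units.inv_mul, hγ.map_one]⟩
      map_one' := Units.ext (by simpa using hγ.map_one)
      map_mul' := fun a b => Units.ext (by
        change γ ((a * b)⁻¹ : LinearMap.GeneralLinearGroup ℝ V) = _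
        rw [mul_inv_rev]
        exact hγ.mult _ _) }

theorem coe_twist_aut (hγ : IsInvolutiveOfKind .aut γ) (g : LinearMap.GeneralLinearGroup ℝ V) :
    (twist hγ g : Module.End ℝ V) = γ g := rfl

theorem coe_twist_antiAut (hγ : IsInvolutiveOfKind .antiAut γ)
    (g : LinearMap.GeneralLinearGroup ℝ V) :
    (twist hγ g : Module.End ℝ V) = γ (g⁻¹ : LinearMap.GeneralLinearGroup ℝ V) := rfl

theorem twist_twist (hγ : IsInvolutiveOfKind κ γ) (g : LinearMap.GeneralLinearGroup ℝ V) :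
    twist hγ (twist hγ g) = g := by
  apply Units.ext
  cases κ with
  | aut => rw [coe_twist_aut, coe_twist_aut, hγ.invol]
  | antiAut => rw [coe_twist_antiAut, ← map_inv, coe_twist_antiAut, inv_inv, hγ.invol]

theorem twist_neg_one (hγ : IsInvolutiveOfKind κ γ) : twist hγ (-1) = -1 := by
  apply Units.ext
  cases κ with
  | aut => rw [coe_twist_aut, Units.val_neg, map_neg, Units.val_one, hγ.map_one]
  | antiAut =>
    rw [coe_twist_antiAut, inv_neg, inv_one, Units.val_neg, map_neg, Units.val_one, hγ.map_one]

theorem mem_structureGroup_iff (hγ : IsInvolutiveOfKind κ γ)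
    (g : LinearMap.GeneralLinearGroup ℝ V) :
    g ∈ structureGroup κ γ hγ ↔ twist hγ g = g := by
  change γ g = ((g ^ κ.sign : LinearMap.GeneralLinearGroup ℝ V) : Module.End ℝ V) ↔ _
  cases κ with
  | aut => rw [← coe_twist_aut hγ, Units.val_inj, Kind.sign, zpow_one]
  | antiAut =>
    rw [← inv_inj (a := twist hγ g), ← map_inv, ← Units.val_inj, coe_twist_antiAut, inv_inv, Kind.sign, zpow_neg,
      zpow_one]

/-- For an anti-automorphism the inverse built into `twist` undoes the reversal of products, so one
formula covers both kinds. -/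
theorem map_conj_eq (hγ : IsInvolutiveOfKind κ γ) (g : LinearMap.GeneralLinearGroup ℝ V)
    (A : Module.End ℝ V) :
    γ ((g : Module.End ℝ V) * A * (g⁻¹ : LinearMap.GeneralLinearGroup ℝ V)) =
      (twist hγ g : Module.End ℝ V) * γ A *
        ((twist hγ g)⁻¹ : LinearMap.GeneralLinearGroup ℝ V) := by
  have hm := hγ.mult
  rw [← map_inv]
  cases κ with
  | aut => rw [hm, hm, coe_twist_aut, coe_twist_aut]
  | antiAut => rw [hm, hm, coe_twist_antiAut, coe_twist_antiAut, inv_inv, mul_assoc]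

theorem conj_mem_eigenspace (hγ : IsInvolutiveOfKind κ γ) {μ : ℝ} {A : Module.End ℝ V}
    (hA : A ∈ Module.End.eigenspace γ μ) {g : LinearMap.GeneralLinearGroup ℝ V}
    (hg : Commute ((g⁻¹ * twist hγ g : LinearMap.GeneralLinearGroup ℝ V) : Module.End ℝ V) A) :
    (g : Module.End ℝ V) * A * (g⁻¹ : LinearMap.GeneralLinearGroup ℝ V) ∈
      Module.End.eigenspace γ μ := by
  rw [Module.End.mem_eigenspace_iff] at hA ⊢
  rw [map_conj_eq hγ, hA, mul_smul_comm, smul_mul_assoc, (Units.conj_eq_conj_iff _ _ _).2 hg]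

end Involution

/-! ### Consequences of indecomposability -/

section Inner

variable {V : Type*} [NormedAddCommGroup V] [InnerProductSpace ℝ V] [FiniteDimensional ℝ V]
  {κ : Kind} {γ : Module.End ℝ (Module.End ℝ V)} {s : LinearMap.GeneralLinearGroup ℝ V}
  {L : Module.End ℝ V}

/-- For an anti-automorphism, γ is the adjoint with respect to the form ω(x, y) = ⟨x, sy⟩. -/
theorem IsStructureMap.inner_eq (hs : IsStructureMap .antiAut γ s) (B : Module.End ℝ V)
    (x y : V) : inner ℝ (B x) ((s : Module.End ℝ V) y) =
      inner ℝ x ((s : Module.End ℝ V) (γ B y)) := by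
  rw [hs B, ← Module.End.mul_apply, ← mul_assoc, ← mul_assoc, Units.mul_inv, one_mul,
    Module.End.mul_apply, LinearMap.adjoint_inner_right]

/-- Symmetric elements of the centralizer of an indecomposable operator are primary. -/
theorem IsIndecomposable.isPrimaryElement (hind : IsIndecomposable κ s L)
    (hγ : IsInvolutiveOfKind κ γ) (hs : IsStructureMap κ γ s)
    {a : Module.End ℝ V} (ha : γ a = a) (haL : Commute a L) : IsPrimaryElement a := by
  intro p q hpq h0
  have hL : ∀ r : ℝ[X], ∀ u ∈ LinearMap.ker (aeval a r), L u ∈ LinearMap.ker (aeval a r) := by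
    intro r u hu
    have hc : aeval a r * L = L * aeval a r := haL.aeval_left r
    rw [LinearMap.mem_ker] at hu ⊢
    rw [← Module.End.mul_apply, hc, Module.End.mul_apply, hu, map_zero]
  obtain ⟨u, v, huv⟩ := hpq
  have hsum (x : V) : aeval a p (aeval a u x) + aeval a q (aeval a v x) = x := by
    have h1 : aeval a (p * u + q * v) x = x := by
      rw [mul_comm p, mul_comm q, huv, map_one, Module.End.one_apply]
    simpa using h1
  have hcomm (f g : ℝ[X]) (x : V) : aeval a f (aeval a g x) = aeval a g (aeval a f x) := by
    rw [← Module.End.mul_apply, ← map_mul, mul_comm, map_mul, Module.End.mul_apply]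
  have h0' (x : V) : aeval a p (aeval a q x) = 0 := LinearMap.congr_fun h0 x
  -- Bézout's identity gives the kernel decomposition of V.
  have hcompl : IsCompl (LinearMap.ker (aeval a p)) (LinearMap.ker (aeval a q)) := by
    refine IsCompl.of_le ?_ ?_
    · rintro x ⟨hx, hx'⟩
      have := hsum x
      rw [hcomm p, hcomm q, hx, hx', map_zero, map_zero, add_zero] at this
      exact this.symm
    · rintro x -
      rw [← hsum x, add_comm]
      refine Submodule.add_mem_sup ?_ ?_
      · exact h0' _
      · rw [LinearMap.mem_ker, hcomm, h0']
  -- Polynomials in a are γ-fixed. For an automorphism they therefore commute with s. For an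
  -- anti-automorphism they are ω-self-adjoint, and each kernel lies in the image of the other
  -- polynomial, whence orthogonality.
  have hsplit : StructureSplits κ s (LinearMap.ker (aeval a p)) (LinearMap.ker (aeval a q)) := by
    cases κ with
    | aut =>
      have hs' (r : ℝ[X]) (x : V) (hx : x ∈ LinearMap.ker (aeval a r)) :
          (s : Module.End ℝ V) x ∈ LinearMap.ker (aeval a r) := by
        have h1 := hs (aeval a r)
        rw [hγ.map_aeval ha, mul_assoc, Units.eq_inv_mul_iff_mul_eq] at h1
        rw [LinearMap.mem_ker] at hx ⊢
        rw [← Module.End.mul_apply, ← h1, Module.End.mul_apply, hx, map_zero]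
      exact ⟨hs' p, hs' q⟩
    | antiAut =>
      have hs' (f g : ℝ[X]) (x y : V) (hx : aeval a f x = 0) (hy : aeval a g y = 0)
          (hfg : ∀ x, aeval a f x = 0 → ∃ z, aeval a g z = x) :
          inner ℝ x ((s : Module.End ℝ V) y) = 0 := by
        obtain ⟨z, rfl⟩ := hfg x hx
        rw [hs.inner_eq, hγ.map_aeval ha, hy, map_zero, inner_zero_right]
      intro x hx y hy
      refine ⟨hs' p q x y hx hy ?_, hs' q p y x hy hx ?_⟩
      · intro x hx
        refine ⟨aeval a v x, ?_⟩
        conv_rhs => rw [← hsum x, hcomm p, hx, map_zero, zero_add]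
      · intro x hx
        refine ⟨aeval a u x, ?_⟩
        conv_rhs => rw [← hsum x, hcomm q, hx, map_zero, add_zero]
  rcases hind _ _ hcompl (hL p) (hL q) hsplit with h | h
  · right
    ext x
    have h1 : aeval a q x ∈ LinearMap.ker (aeval a p) := h0' x
    rw [h] at h1
    simpa using h1
  · left
    ext x
    have h1 : aeval a p x ∈ LinearMap.ker (aeval a q) := by rw [LinearMap.mem_ker, hcomm, h0']
    rw [h] at h1
    simpa using h1

/-- A cocycle `h` of the involution `twist` in the centralizer of an indecomposable operator is,
up to sign, a coboundary. -/
theorem IsIndecomposable.exists_twist_mul_eq (hind : IsIndecomposable κ s L)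
    (hγ : IsInvolutiveOfKind κ γ) (hs : IsStructureMap κ γ s)
    {h : LinearMap.GeneralLinearGroup ℝ V} (hh : twist hγ h = h⁻¹)
    (hhL : Commute (h : Module.End ℝ V) L) :
    ∃ f : LinearMap.GeneralLinearGroup ℝ V, Commute (f : Module.End ℝ V) L ∧
      (twist hγ f * h = f ∨ twist hγ f * h = -f) := by
  cases κ with
  | aut =>
    have h1 : γ h = (h⁻¹ : LinearMap.GeneralLinearGroup ℝ V) := by rw [← coe_twist_aut hγ, hh]
    have h2 : γ (h⁻¹ : LinearMap.GeneralLinearGroup ℝ V) = h := by rw [← h1, hγ.invol]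
    have hprim := hind.isPrimaryElement hγ hs
      (a := (h : Module.End ℝ V) + (h⁻¹ : LinearMap.GeneralLinearGroup ℝ V))
      (by rw [map_add, h1, h2, add_comm]) (hhL.add_left hhL.units_inv_left)
    -- With f = 1 ± h, τ(f)h = (1 ± h⁻¹)h = h ± 1 = ±f.
    rcases hprim.isUnit_one_add_or_one_sub with ⟨f, hf⟩ | ⟨f, hf⟩
    · refine ⟨f, hf ▸ (Commute.one_left L).add_left hhL, Or.inl (Units.ext ?_)⟩
      rw [Units.val_mul, coe_twist_aut, hf, map_add, hγ.map_one, h1, add_mul, Units.inv_mul,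
        one_mul, add_comm]
    · refine ⟨f, hf ▸ (Commute.one_left L).sub_left hhL, Or.inr (Units.ext ?_)⟩
      rw [Units.val_mul, coe_twist_aut, Units.val_neg, hf, map_sub, hγ.map_one, h1, sub_mul,
        Units.inv_mul, one_mul, neg_sub]
  | antiAut =>
    have h1 : γ h = h := by
      rw [← inv_inv h, ← coe_twist_antiAut hγ, map_inv, hh]
    have hprim := hind.isPrimaryElement hγ hs h1 hhL
    obtain ⟨r, hr⟩ := hprim.exists_sq_eq h.isUnit
    obtain ⟨f, hf⟩ : IsUnit (aeval (h : Module.End ℝ V) r) := by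
      rw [← isUnit_pow_iff two_ne_zero, sq]
      rcases hr with hr | hr <;> rw [hr]
      · exact h.isUnit
      · exact h.isUnit.neg
    -- As a polynomial in h, f is γ-fixed, so τ(f) = f⁻¹ and τ(f)h = ±f amounts to f² = ±h.
    have h3 : ((twist hγ f)⁻¹ : LinearMap.GeneralLinearGroup ℝ V) = f := by
      rw [← map_inv]
      apply Units.ext
      rw [coe_twist_antiAut, inv_inv, hf, hγ.map_aeval h1]
    refine ⟨f, hf ▸ hhL.aeval_left r, ?_⟩
    rw [← hf] at hr
    refine hr.imp (fun hr => ?_) (fun hr => ?_)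
    · rw [← eq_inv_mul_iff_mul_eq, h3]
      exact Units.ext hr.symm
    · rw [← eq_inv_mul_iff_mul_eq, h3]
      apply Units.ext
      rw [Units.val_mul, Units.val_neg, mul_neg, hr, neg_neg]

/-- An operator in the conjugation orbit of `L` and in the eigenspace of `L` is conjugate to `L` by
an element that the involution `twist` fixes up to sign. -/
theorem IsIndecomposable.exists_conj_eq (hind : IsIndecomposable κ s L)
    (hγ : IsInvolutiveOfKind κ γ) (hs : IsStructureMap κ γ s) {μ : ℝ}
    (hL : L ∈ Module.End.eigenspace γ μ) (g : LinearMap.GeneralLinearGroup ℝ V)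
    (hM : (g : Module.End ℝ V) * L * (g⁻¹ : LinearMap.GeneralLinearGroup ℝ V) ∈
      Module.End.eigenspace γ μ) :
    ∃ k : LinearMap.GeneralLinearGroup ℝ V, (twist hγ k = k ∨ twist hγ k = -k) ∧
      (g : Module.End ℝ V) * L * (g⁻¹ : LinearMap.GeneralLinearGroup ℝ V) =
        (k : Module.End ℝ V) * L * (k⁻¹ : LinearMap.GeneralLinearGroup ℝ V) := by
  rw [Module.End.mem_eigenspace_iff] at hL hM
  rcases eq_or_ne μ 0 with rfl | hμ
  · have hL0 : L = 0 := by rw [← hγ.invol L, hL, zero_smul, map_zero]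
    exact ⟨1, Or.inl (map_one _), by simp [hL0]⟩
  rw [map_conj_eq hγ, hL, mul_smul_comm, smul_mul_assoc] at hM
  have hcomm := (Units.conj_eq_conj_iff _ _ _).1 (smul_right_injective _ hμ hM).symm
  obtain ⟨f, hfL, hf⟩ := hind.exists_twist_mul_eq hγ hs
    (by rw [map_mul, map_inv, twist_twist, mul_inv_rev, inv_inv]) hcomm
  -- For k = gf⁻¹, k⁻¹g = f centralizes L, and τ(f)τ(g)⁻¹g = ±f rearranges to τ(k) = ±k.
  refine ⟨g * f⁻¹, ?_, (Units.conj_eq_conj_iff _ _ _).2 (by simpa using hfL)⟩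
  rw [map_mul, map_inv]
  refine hf.imp (fun hf => ?_) (fun hf => ?_)
  · have h1 : f⁻¹ = (twist hγ f * ((twist hγ g)⁻¹ * g))⁻¹ := by rw [hf]
    rw [h1]
    group
  · have h1 : f⁻¹ = -(twist hγ f * ((twist hγ g)⁻¹ * g))⁻¹ := by rw [hf, inv_neg, neg_neg]
    rw [h1, mul_neg, neg_neg]
    group

end Inner

end OrbitSplitting
-- Counting the orbits
theorem mainTheorem1 {V : Type*} [NormedAddCommGroup V] [InnerProductSpace ℝ V]
    [FiniteDimensional ℝ V] (κ : OrbitSplitting.Kind)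
    (γ : Module.End ℝ (Module.End ℝ V)) (hγ : OrbitSplitting.IsInvolutiveOfKind κ γ)
    (s : LinearMap.GeneralLinearGroup ℝ V) (hs : OrbitSplitting.IsStructureMap κ γ s)
    (μ : ℝ) (L : Module.End ℝ V) (hL : L ∈ Module.End.eigenspace γ μ)
    (hind : OrbitSplitting.IsIndecomposable κ s L) :
    ∃ M₁ M₂ : Module.End ℝ V,
      OrbitSplitting.conjOrbit ⊤ L ∩ (Module.End.eigenspace γ μ : Set (Module.End ℝ V)) =
        OrbitSplitting.conjOrbit (OrbitSplitting.structureGroup κ γ hγ) M₁ ∪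
          OrbitSplitting.conjOrbit (OrbitSplitting.structureGroup κ γ hγ) M₂ := by
  have key (k₀ k : LinearMap.GeneralLinearGroup ℝ V)
      (h : k * k₀⁻¹ ∈ OrbitSplitting.structureGroup κ γ hγ) :
      (k : Module.End ℝ V) * L * (k⁻¹ : LinearMap.GeneralLinearGroup ℝ V) ∈
        OrbitSplitting.conjOrbit (OrbitSplitting.structureGroup κ γ hγ)
          ((k₀ : Module.End ℝ V) * L * (k₀⁻¹ : LinearMap.GeneralLinearGroup ℝ V)) :=
    ⟨k * k₀⁻¹, h, by simp [mul_assoc]⟩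
  have key' {k₀ : LinearMap.GeneralLinearGroup ℝ V}
      (hk₀ : OrbitSplitting.twist hγ k₀ = k₀ ∨ OrbitSplitting.twist hγ k₀ = -k₀) :
      OrbitSplitting.conjOrbit (OrbitSplitting.structureGroup κ γ hγ)
          ((k₀ : Module.End ℝ V) * L * (k₀⁻¹ : LinearMap.GeneralLinearGroup ℝ V)) ⊆
        OrbitSplitting.conjOrbit ⊤ L ∩ (Module.End.eigenspace γ μ : Set (Module.End ℝ V)) := by
    rintro _ ⟨g, hg, rfl⟩
    rw [OrbitSplitting.mem_structureGroup_iff] at hg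
    have e : (g : Module.End ℝ V) * ((k₀ : Module.End ℝ V) * L *
        (k₀⁻¹ : LinearMap.GeneralLinearGroup ℝ V)) * (g⁻¹ : LinearMap.GeneralLinearGroup ℝ V) =
        ((g * k₀ : LinearMap.GeneralLinearGroup ℝ V) : Module.End ℝ V) * L *
          ((g * k₀)⁻¹ : LinearMap.GeneralLinearGroup ℝ V) := by
      simp [mul_assoc]
    rw [e]
    refine ⟨⟨_, trivial, rfl⟩, OrbitSplitting.conj_mem_eigenspace hγ hL ?_⟩
    rcases hk₀ with hk₀ | hk₀ <;> rw [map_mul, hg, hk₀]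
    · simp
    · rw [mul_neg, mul_neg, inv_mul_cancel, Units.val_neg, Units.val_one]
      exact (Commute.one_left L).neg_left
  obtain ⟨k₀, hk₀, hk⟩ : ∃ k₀ : LinearMap.GeneralLinearGroup ℝ V,
      (OrbitSplitting.twist hγ k₀ = k₀ ∨ OrbitSplitting.twist hγ k₀ = -k₀) ∧
      ∀ k, OrbitSplitting.twist hγ k = -k → OrbitSplitting.twist hγ (k * k₀⁻¹) = k * k₀⁻¹ := by
    -- If no k has τ(k) = −k, the default k₀ = 1 makes the two orbits coincide. Otherwise, for any
    -- two such elements, the signs cancel in τ(kk₀⁻¹).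
    by_cases h : ∃ k₀, OrbitSplitting.twist hγ k₀ = -k₀
    · obtain ⟨k₀, hk₀⟩ := h
      exact ⟨k₀, Or.inr hk₀, fun k hk => by
        rw [map_mul, map_inv, hk, hk₀, inv_neg, neg_mul_neg]⟩
    · exact ⟨1, Or.inl (map_one _), fun k hk => absurd ⟨k, hk⟩ h⟩
  refine ⟨_, _, Set.Subset.antisymm ?_
    (Set.union_subset (key' (k₀ := 1) (Or.inl (map_one _))) (key' hk₀))⟩
  rintro _ ⟨⟨g, -, rfl⟩, hM⟩
  obtain ⟨k, h, e⟩ := hind.exists_conj_eq hγ hs hL g hM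
  rw [e]
  refine h.imp (fun h => key 1 k ?_) (fun h => key k₀ k ?_)
  · rw [OrbitSplitting.mem_structureGroup_iff, inv_one, mul_one, h]
  · rw [OrbitSplitting.mem_structureGroup_iff, hk k h]
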